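/- Let $M$ be an $n$-dimensional (Hausdorff) smooth manifold with tangent bundle $\tau_M:TM\to M$, and let $\pi_M:L(M)\to M$ be its bundle of linear frames, where a frame $u$ at $x$ is a linear isomorphism $u:\mathbb R^n\to T_xM$ and $GL(n;\mathbb R)$ acts on the right by $ua=u\circ a$. Let $\omega$ be a linear connection on $M$, i.e. a (smooth, $\mathfrak{gl}(n;\mathbb R)$-valued) principal connection one-form on $L(M)$, and let $\nabla$ be the corresponding affine connection: for smooth vector fields $Y$ on $M$, $w\in T_xM$ and any frame $u$ at $x$, $\nabla_wY=u\big(w^h f_Y\big)$, where $f_Y(u)=u^{-1}(Y(\pi_M(u)))$ and $w^h\in T_uL(M)$ is the horizontal lift of $w$, i.e. the unique vector with $\omega(w^h)=0$ and $T_u\pi_M(w^h)=w$. For $\xi\in\mathbb R^n$ let $B(\xi)_u\in T_uL(M)$ be the horizontal lift of $u\xi$ to $u$, and let $\Phi_\xi:L(M)\to TM$, $\Phi_\xi(u)=u\xi$. The geodesic spray $Z:TM\to TTM$ is defined by $Z(v)=T_u\Phi_\xi(B(\xi)_u)$ for any frame $u$ and any $\xi\in\mathbb R^n$ with $u\xi=v$.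 For a smooth vector field $X$ on $M$ with (local) flow $\phi^X_t$, the tangent lift $X^T$ is the vector field on $TM$ given by $X^T(v)=\frac{d}{dt}\big|_{t=0}T\phi^X_t(v)$. For $v,w\in T_xM$ the vertical lift is $\mathrm{vlft}_v(w)=\frac{d}{dt}\big|_{t=0}(v+tw)\in T_v(TM)$. Then for every $x\in M$, every $v\in T_xM$ and every smooth vector field $X_v$ on $M$ with $X_v(x)=v$, $$Z(v)=(X_v)^T(v)-\mathrm{vlft}_v\big(\nabla_{X_v}X_v(x)\big)$$ in $T_v(TM)$. In particular the right-hand side does not depend on the choice of the extension $X_v$ of $v$. -/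

import Mathlib

open Bundle Set
open scoped Manifold ContDiff Topology

noncomputable section

namespace FrameSpray

/-- The tangent vector at `p` of a curve `γ` in `N` with `γ 0 = p`, namely `d/dt|_{t=0} γ t`. -/
def curveVelocity {F : Type*} [NormedAddCommGroup F] [NormedSpace ℝ F]
    {H : Type*} [TopologicalSpace H] (J : ModelWithCorners ℝ F H)
    {N : Type*} [TopologicalSpace N] [ChartedSpace H N]
    (γ : ℝ → N) (p : N) (h : γ 0 = p) : TangentSpace J p :=
  h ▸ (mfderiv 𝓘(ℝ, ℝ) J γ 0 (1 : ℝ) : TangentSpace J (γ 0))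

/-- The model space `ℝⁿ`. -/
abbrev Rn (n : ℕ) : Type := EuclideanSpace ℝ (Fin n)

/-- The Lie algebra `𝔤𝔩(n, ℝ)`, as the space of linear endomorphisms of `ℝⁿ`. -/
abbrev gl (n : ℕ) : Type := Rn n →L[ℝ] Rn n

section

variable {n : ℕ} {M : Type*} [TopologicalSpace M] [ChartedSpace (Rn n) M]

open Classical in
/-- The flow `φ_t^X(y)` of a vector field `X`: the value at time `t` of an integral curve of `X`
which starts at `y` and is defined on an open interval containing `0` and `t`. If there is no
such curve, the value is `y` by convention. -/
def flow (X : Π x : M, TangentSpace (𝓡 n) x) (t : ℝ) (y : M) : M :=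
  if h : ∃ γ : ℝ → M, γ 0 = y ∧
      ∃ a b : ℝ, 0 ∈ Ioo a b ∧ t ∈ Ioo a b ∧ IsMIntegralCurveOn γ X (Ioo a b)
  then h.choose t else y

theorem flow_zero (X : Π x : M, TangentSpace (𝓡 n) x) : flow X 0 = id := by
  funext y
  unfold flow
  split_ifs with h
  · exact h.choose_spec.1
  · rfl

theorem tangentMap_flow_zero (X : Π x : M, TangentSpace (𝓡 n) x) (v : TangentBundle (𝓡 n) M) :
    tangentMap (𝓡 n) (𝓡 n) (flow X 0) v = v := by
  rw [flow_zero, tangentMap_id]; rfl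

end

section

variable (n : ℕ) (M : Type*) [TopologicalSpace M] [ChartedSpace (Rn n) M]
  [IsManifold (𝓡 n) ∞ M]

/-- The total space of the vector bundle `Hom(ℝⁿ, TM)` over `M`. -/
abbrev HomBundle : Type _ :=
  TotalSpace (gl n) (fun x : M => Bundle.Trivial M (Rn n) x →L[ℝ] TangentSpace (𝓡 n) x)

/-- Being a linear isomorphism is an open condition in `Hom(ℝⁿ, TM)`. -/
theorem isOpen_frames :
    IsOpen {u : HomBundle n M | ContinuousLinearMap.IsInvertible u.2} := by
  rw [isOpen_iff_mem_nhds]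
  intro p₀ hp₀
  let e₁ := trivializationAt (Rn n) (Bundle.Trivial M (Rn n)) p₀.1
  let e₂ := trivializationAt (Rn n) (TangentSpace (𝓡 n) : M → Type _) p₀.1
  let e := trivializationAt (gl n)
    (fun x : M => Bundle.Trivial M (Rn n) x →L[ℝ] TangentSpace (𝓡 n) x) p₀.1
  have key : ∀ p : HomBundle n M, p ∈ e.source →
      (ContinuousLinearMap.IsInvertible (e p).2 ↔ ContinuousLinearMap.IsInvertible p.2) := by
    intro p hp
    have hp' : p.1 ∈ e₁.baseSet ∩ e₂.baseSet := hp
    have h : (e p).2 = (e₂.continuousLinearEquivAt ℝ p.1 hp'.2 : _ →L[ℝ] Rn n) ∘L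
        (p.2 ∘L ((e₁.continuousLinearEquivAt ℝ p.1 hp'.1).symm : Rn n →L[ℝ] _)) := by
      rw [Trivialization.coe_continuousLinearEquivAt_eq',
        Trivialization.symm_continuousLinearEquivAt_eq']
      rfl
    rw [h, ContinuousLinearMap.isInvertible_equiv_comp, ContinuousLinearMap.isInvertible_comp_equiv]
  have hmem : p₀ ∈ e.source := FiberBundle.mem_trivializationAt_proj_source
  have hopen : IsOpen {L : gl n | L.IsInvertible} := ContinuousLinearEquiv.isOpen
  have hU := e.isOpen_inter_preimage (hopen.preimage (continuous_snd (X := M)))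
  refine Filter.mem_of_superset (hU.mem_nhds ⟨hmem, (key p₀ hmem).2 hp₀⟩) ?_
  rintro p ⟨hp, hpU⟩
  exact (key p hp).1 hpU

/-- The bundle of linear frames `L(M)`: pairs of a point `x` and a linear isomorphism
`u : ℝⁿ → T_xM`, an open submanifold of `Hom(ℝⁿ, TM)`. -/
def frames : TopologicalSpace.Opens (HomBundle n M) :=
  ⟨{u | ContinuousLinearMap.IsInvertible u.2}, isOpen_frames n M⟩

/-- The bundle of linear frames `L(M)` as a manifold. -/
abbrev FrameBundle : Type _ := frames n M

/-- The model with corners of the manifold `L(M)`. -/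
abbrev frameModel : ModelWithCorners ℝ (Rn n × gl n) (ModelProd (Rn n) (gl n)) :=
  (𝓡 n).prod 𝓘(ℝ, gl n)

instance : IsManifold (frameModel n) ∞ (HomBundle n M) :=
  Bundle.TotalSpace.isManifold _ _

instance : IsManifold (frameModel n) ∞ (FrameBundle n M) := inferInstance

instance : IsManifold (frameModel n) 1 (FrameBundle n M) :=
  IsManifold.of_le (n := ∞) (by exact_mod_cast le_top)

end

variable {n : ℕ} {M : Type*} [TopologicalSpace M] [ChartedSpace (Rn n) M]
  [IsManifold (𝓡 n) ∞ M]

namespace FrameBundle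

/-- The base point of a frame: the projection `π_M : L(M) → M`. -/
def proj (u : FrameBundle n M) : M := u.1.1

/-- A frame `u` at `x` as a linear map `ℝⁿ → T_xM`. -/
def toMap (u : FrameBundle n M) : Rn n →L[ℝ] TangentSpace (𝓡 n) (proj u) := u.1.2

theorem isInvertible_toMap (u : FrameBundle n M) : (toMap u).IsInvertible := u.2

/-- The right action of `GL(n, ℝ)` on frames, `u a = u ∘ a`. -/
def act (u : FrameBundle n M) (a : (gl n)ˣ) : FrameBundle n M :=
  ⟨⟨proj u, (toMap u).comp (a : gl n)⟩,
    (isInvertible_toMap u).comp ⟨ContinuousLinearEquiv.ofUnit a, rfl⟩⟩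

/-- The association map `Φ_ξ : L(M) → TM`, `u ↦ u ξ`. -/
def assoc (ξ : Rn n) (u : FrameBundle n M) : TangentBundle (𝓡 n) M :=
  ⟨proj u, toMap u ξ⟩

/-- The function `f_Y : L(M) → ℝⁿ`, `f_Y(u) = u⁻¹(Y(π_M(u)))`, of a vector field `Y` on `M`. -/
def coordFun (Y : Π x : M, TangentSpace (𝓡 n) x) (u : FrameBundle n M) : Rn n :=
  (toMap u).inverse (Y (proj u))

/-- The element `exp(tA)` of `GL(n, ℝ)`. -/
def expUnit (A : gl n) (t : ℝ) : (gl n)ˣ :=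
  letI : NormedAlgebra ℚ (gl n) := NormedAlgebra.restrictScalars ℚ ℝ (gl n)
  (NormedSpace.isUnit_exp (t • A)).unit

theorem act_expUnit_zero (u : FrameBundle n M) (A : gl n) : act u (expUnit A 0) = u := by
  have h : expUnit A 0 = 1 := by
    ext1
    have h0 : (0 : ℝ) • A = 0 := zero_smul ℝ A
    simp [expUnit, h0, NormedSpace.exp_zero]
  rw [h]
  rfl

/-- The value at `u` of the infinitesimal generator `A_{L(M)}` of `A ∈ 𝔤𝔩(n, ℝ)`:
`d/dt|_{t=0} u exp(tA)`. -/
def generator (A : gl n) (u : FrameBundle n M) : TangentSpace (frameModel n) u :=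
  curveVelocity (frameModel n) (fun t => act u (expUnit A t)) u (act_expUnit_zero u A)

end FrameBundle

open FrameBundle

variable (n M) in
/-- A linear connection on `M`: a connection one-form on the principal bundle `L(M)`. -/
structure LinearConnection where
  /-- The `𝔤𝔩(n, ℝ)`-valued one-form. -/
  form : Π u : FrameBundle n M, TangentSpace (frameModel n) u →L[ℝ] gl n
  /-- The one-form is smooth, as a map `TL(M) → 𝔤𝔩(n, ℝ)`. -/
  smooth : ContMDiff (frameModel n).tangent 𝓘(ℝ, gl n) ∞
    (fun p : TangentBundle (frameModel n) (FrameBundle n M) => form p.1 p.2)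
  /-- The one-form reproduces the generators of the right action. -/
  form_generator : ∀ (A : gl n) (u : FrameBundle n M), form u (FrameBundle.generator A u) = A
  /-- The one-form is of type `Ad`: `ω_{ua}(TΦ_a w) = a⁻¹ ω_u(w) a`. -/
  form_equivariant : ∀ (a : (gl n)ˣ) (u : FrameBundle n M) (w : TangentSpace (frameModel n) u),
    form (act u a)
      (mfderiv (frameModel n) (frameModel n) (fun u' : FrameBundle n M => act u' a) u w)
      = ((a⁻¹ : (gl n)ˣ) : gl n) ∘L form u w ∘L (a : gl n)

namespace LinearConnection

variable (conn : LinearConnection n M)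

/-- The horizontal lift at the frame `u` of `w ∈ T_xM`, where `x = π_M(u)`: the unique vector
at `u` that is horizontal (`ω_u = 0`) and is mapped to `w` by `Tπ_M`. -/
def horLift (u : FrameBundle n M) (w : TangentSpace (𝓡 n) (proj u)) :
    TangentSpace (frameModel n) u :=
  Classical.epsilon fun B : TangentSpace (frameModel n) u =>
    conn.form u B = 0 ∧ mfderiv (frameModel n) (𝓡 n) (proj : FrameBundle n M → M) u B = w

/-- The standard horizontal vector field `B(ξ)` on `L(M)`: the unique horizontal vector at `u`
with `T_uπ_M(B(ξ)_u) = u ξ`. -/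
def stdHor (ξ : Rn n) (u : FrameBundle n M) : TangentSpace (frameModel n) u :=
  conn.horLift u (toMap u ξ)

/-- The geodesic spray `Z : TM → TTM` of a linear connection: `Z(v)` is the vector with
`Z(v) = T_uΦ_ξ(B(ξ)_u)` for all frames `u` and all `ξ ∈ ℝⁿ` such that `u ξ = v`. -/
def geodesicSpray (v : TangentBundle (𝓡 n) M) : TangentSpace (𝓡 n).tangent v :=
  Classical.epsilon fun Z : TangentSpace (𝓡 n).tangent v =>
    ∀ (u : FrameBundle n M) (ξ : Rn n) (h : assoc ξ u = v),
      Z = h ▸ (mfderiv (frameModel n) (𝓡 n).tangent (assoc ξ) u (conn.stdHor ξ u) :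
        TangentSpace (𝓡 n).tangent (assoc ξ u))

/-- `∇` is the affine connection corresponding to `ω`: for all smooth vector fields `Y`,
`∇_wY = u (w^h f_Y)`, where `w^h` is the horizontal lift to the frame `u` of `w ∈ T_xM`.
(In Mathlib `nabla Y x w` is `∇_w Y`.) -/
def Corresponds
    (nabla : CovariantDerivative (𝓡 n) (Rn n) (TangentSpace (𝓡 n) : M → Type _)) : Prop :=
  ∀ Y : Π x : M, TangentSpace (𝓡 n) x,
    ContMDiff (𝓡 n) (𝓡 n).tangent ∞ (fun x => (⟨x, Y x⟩ : TangentBundle (𝓡 n) M)) →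
    ∀ (u : FrameBundle n M) (w : TangentSpace (𝓡 n) (proj u)),
      nabla Y (proj u) w =
        toMap u (mfderiv (frameModel n) 𝓘(ℝ, Rn n) (coordFun Y) u (conn.horLift u w))

end LinearConnection

/-- The tangent lift `X^T` of a vector field `X`: `X^T(v) = d/dt|_{t=0} Tφ_t^X(v)`. -/
def tangentLift (X : Π x : M, TangentSpace (𝓡 n) x) (v : TangentBundle (𝓡 n) M) :
    TangentSpace (𝓡 n).tangent v :=
  curveVelocity (𝓡 n).tangent (fun t => tangentMap (𝓡 n) (𝓡 n) (flow X t) v) v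
    (tangentMap_flow_zero X v)

/-- The vertical lift `vlft_v(w) = d/dt|_{t=0} (v + t w)` of `w ∈ T_xM` at `v ∈ T_xM`. -/
def vlft {x : M} (v w : TangentSpace (𝓡 n) x) :
    TangentSpace (𝓡 n).tangent (⟨x, v⟩ : TangentBundle (𝓡 n) M) :=
  curveVelocity (𝓡 n).tangent (fun t : ℝ => (⟨x, v + t • w⟩ : TangentBundle (𝓡 n) M)) ⟨x, v⟩
    (by simp)

end FrameSpray

end

/-! Choose a frame `u` and `ξ` with `u ξ = v`. Since `X x = v`, necessarily `ξ = f_X(u)`. On all of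
`L(M)` the identity `X(π(u')) = u' f_X(u')` holds, that is, `X ∘ π` is the evaluation map `(u', η) ↦
u' η` restricted to the graph of `f_X`. Differentiating along the horizontal lift `B` of `v` at `u`
gives `TX(v) = TΦ_ξ(B) + T(η ↦ u η)(B f_X)` (`mfderiv_section_eq_add`). The first summand is the
spray; the second is the vertical lift of `u (B f_X) = ∇_v X` (`vlft_toMap`). As `u` and `ξ` are
arbitrary, the same computation shows that the spray does not depend on them (`geodesicSpray_eq`).

It remains to see that `X^T(X x) = TX(X x)` (`tangentLift_apply_self`). A field is invariant under
its own flow: differentiating `φ_t(γ s) = γ (s + t)` at `s = 0` yields `Tφ_t(X x) = X(γ t)`, whose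
velocity at `t = 0` is `TX(X x)`. This chain rule needs `φ_t` to be differentiable at `x`, for
otherwise `mfderiv` is zero by default. The analytic part supplies this differentiability by
comparing nearby solutions with the linearised equation through Grönwall's inequality. -/

noncomputable section

namespace FrameSpray

/-! ### Differentiability of a local flow in its initial value, in a normed space. -/

section ODE

variable {E : Type*} [NormedAddCommGroup E] [NormedSpace ℝ E]

/-- Second-order Taylor bound for a function whose derivative is Lipschitz on a convex set. -/
theorem norm_sub_sub_fderiv_le {f : E → E} {s : Set E} (hs : Convex ℝ s) {L : NNReal}
    (hf : ∀ y ∈ s, DifferentiableAt ℝ f y) (hL : LipschitzOnWith L (fderiv ℝ f) s)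
    {y z : E} (hy : y ∈ s) (hz : z ∈ s) :
    ‖f z - f y - fderiv ℝ f y (z - y)‖ ≤ L * ‖z - y‖ ^ 2 := by
  have hseg : segment ℝ y z ⊆ s := hs.segment_subset hy hz
  have := (convex_segment (𝕜 := ℝ) y z).norm_image_sub_le_of_norm_hasFDerivWithin_le'
    (f := f) (f' := fderiv ℝ f) (φ := fderiv ℝ f y) (C := L * ‖z - y‖)
    (fun w hw => (hf w (hseg hw)).hasFDerivAt.hasFDerivWithinAt)
    (fun w hw => by
      refine (hL.norm_sub_le (hseg hw) hy).trans ?_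
      gcongr
      obtain ⟨a, b, ha, hb, hab, rfl⟩ := hw
      have : a • y + b • z - y = b • (z - y) := by
        rw [show a = 1 - b by linarith]; module
      rw [this, norm_smul, Real.norm_of_nonneg hb]
      exact mul_le_of_le_one_left (norm_nonneg _) (by linarith))
    (left_mem_segment ℝ y z) (right_mem_segment ℝ y z)
  rw [pow_two, ← mul_assoc]
  exact this

/-- The time-`T` map of a family of solutions of an autonomous equation is differentiable in the
initial value, with derivative given by a solution of the linearised equation. -/
theorem hasFDerivAt_of_linearised {f : E → E} {p : E} {s : Set E} (hs : Convex ℝ s)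
    {K L : NNReal} (hf : ∀ y ∈ s, DifferentiableAt ℝ f y) (hK : LipschitzOnWith K f s)
    (hL : LipschitzOnWith L (fderiv ℝ f) s) {T : ℝ} (hT : 0 ≤ T)
    {c : ℝ → E} {A : ℝ → E →L[ℝ] E} (hc0 : c 0 = p) (hA0 : A 0 = .id ℝ E)
    (hc : ∀ t ∈ Icc 0 T, HasDerivAt c (f (c t)) t)
    (hA : ∀ t ∈ Icc 0 T, HasDerivAt A (fderiv ℝ f (c t) ∘L A t) t)
    {C : ℝ} (hC : ∀ t ∈ Icc 0 T, ‖A t‖ ≤ C)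
    (hcs : ∀ᶠ h in 𝓝 (0 : E), ∀ t ∈ Icc 0 T, c t + A t h ∈ s)
    {α : E → ℝ → E} (hα : ∀ᶠ y in 𝓝 p, α y 0 = y ∧
      ∀ t ∈ Icc 0 T, HasDerivAt (α y) (f (α y t)) t ∧ α y t ∈ s) :
    HasFDerivAt (fun y => α y T) (A T) p := by
  have hTm : T ∈ Icc 0 T := ⟨hT, le_rfl⟩
  have hsub : Filter.Tendsto (fun y => y - p) (𝓝 p) (𝓝 0) := by
    have : Continuous fun y : E => y - p := by fun_prop
    simpa using this.tendsto p
  have hcmem : ∀ t ∈ Icc 0 T, c t ∈ s := fun t ht => by simpa using hcs.self_of_nhds t ht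
  -- A strictly positive constant selects the exponential form of the Grönwall bound, with no
  -- separate case `K = 0`.
  have hLK : LipschitzOnWith (K + 1) f s := hK.weaken (by simp)
  set D : ℝ := L * C ^ 2 / (K + 1) * (Real.exp ((K + 1) * T) - 1) with hD
  have key : ∀ᶠ y in 𝓝 p, ‖α y T - (c T + A T (y - p))‖ ≤ D * ‖y - p‖ ^ 2 := by
    filter_upwards [hα, hsub.eventually hcs] with y hy hys
    have hder : ∀ t ∈ Icc 0 T, HasDerivAt (fun t => c t + A t (y - p))
        (f (c t) + fderiv ℝ f (c t) (A t (y - p))) t := fun t ht => by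
      have := (hc t ht).add ((hA t ht).clm_apply (hasDerivAt_const t (y - p)))
      rw [map_zero, add_zero] at this
      exact this
    -- With `h = y - p`, the curve `c t + A t h` solves the equation up to the Taylor remainder, at
    -- most `L * C ^ 2 * ‖h‖ ^ 2`, and has the same initial value as `α y`. Grönwall therefore keeps
    -- the two curves within `D * ‖h‖ ^ 2`.
    have := dist_le_of_approx_trajectories_ODE_of_mem (v := fun _ => f) (s := fun _ => s)
      (K := K + 1) (f := α y) (g := fun t => c t + A t (y - p)) (a := 0) (b := T)
      (f' := fun t => f (α y t)) (g' := fun t => f (c t) + fderiv ℝ f (c t) (A t (y - p)))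
      (εf := 0) (εg := L * C ^ 2 * ‖y - p‖ ^ 2) (δ := 0)
      (fun _ _ => hLK)
      (fun t ht => ((hy.2 t ht).1).continuousAt.continuousWithinAt)
      (fun t ht => ((hy.2 t (Ico_subset_Icc_self ht)).1).hasDerivWithinAt)
      (fun t ht => by simp)
      (fun t ht => (hy.2 t (Ico_subset_Icc_self ht)).2)
      (fun t ht => (hder t ht).continuousAt.continuousWithinAt)
      (fun t ht => (hder t (Ico_subset_Icc_self ht)).hasDerivWithinAt)
      (fun t ht => by
        have ht' := Ico_subset_Icc_self ht
        have h1 := norm_sub_sub_fderiv_le hs hf hL (hcmem t ht') (hys t ht')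
        have h2 : ‖A t (y - p)‖ ≤ C * ‖y - p‖ := (A t).le_of_opNorm_le (hC t ht') _
        rw [dist_comm, dist_eq_norm, ← sub_sub]
        simp only [add_sub_cancel_left] at h1
        refine h1.trans ?_
        rw [mul_assoc, ← mul_pow]
        gcongr)
      (fun t ht => hys t (Ico_subset_Icc_self ht))
      (by simp [hy.1, hc0, hA0])
      T hTm
    rw [dist_eq_norm, gronwallBound_of_K_ne_0 (by positivity)] at this
    refine this.trans (le_of_eq ?_)
    rw [hD]
    push_cast
    simp only [zero_add, zero_mul, sub_zero]
    ring
  have hp : α p T = c T := by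
    have := key.self_of_nhds
    simpa [sub_eq_zero] using this
  refine HasFDerivAt.of_isLittleO ?_
  refine Asymptotics.IsBigO.trans_isLittleO (g := fun y => ‖y - p‖ ^ 2) ?_ ?_
  · refine Asymptotics.IsBigO.of_bound D ?_
    filter_upwards [key] with y hy
    rw [hp, norm_pow, norm_norm, sub_sub]
    exact hy
  · exact (Asymptotics.isLittleO_norm_pow_id (by norm_num : 1 < 2)).comp_tendsto hsub

/-- A `C²` vector field has a local flow whose time-`t` maps are differentiable at the centre and
which stays in a prescribed neighbourhood. -/
theorem exists_localFlow_differentiableAt [CompleteSpace E] {f : E → E} {p : E}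
    (hf : ContDiffAt ℝ 2 f p) {U : Set E} (hU : U ∈ 𝓝 p) :
    ∃ ε > 0, ∃ α : E → ℝ → E,
      (∀ᶠ y in 𝓝 p, α y 0 = y ∧
        ∀ t ∈ Ioo (-ε) ε, HasDerivAt (α y) (f (α y t)) t ∧ α y t ∈ U) ∧
      ∀ t ∈ Ioo (-ε) ε, DifferentiableAt ℝ (fun y => α y t) p := by
  have hf1 : ContDiffAt ℝ 1 f p := hf.of_le (by norm_num)
  have hdf : ContDiffAt ℝ 1 (fderiv ℝ f) p := hf.fderiv_right (by norm_num)
  obtain ⟨K, sK, hsK, hK⟩ := hf1.exists_lipschitzOnWith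
  obtain ⟨L, sL, hsL, hL⟩ := hdf.exists_lipschitzOnWith
  have hdiff : ∀ᶠ y in 𝓝 p, DifferentiableAt ℝ f y :=
    (hf1.eventually (by simp)).mono fun y hy => hy.differentiableAt (by norm_num)
  obtain ⟨R, hR, hball⟩ := Metric.mem_nhds_iff.1
    (Filter.inter_mem (Filter.inter_mem hsK hsL) (Filter.inter_mem hU hdiff))
  set s := Metric.ball p R with hs
  have hsc : Convex ℝ s := convex_ball p R
  have hK : LipschitzOnWith K f s := hK.mono fun y hy => (hball hy).1.1
  have hL : LipschitzOnWith L (fderiv ℝ f) s := hL.mono fun y hy => (hball hy).1.2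
  have hdiff : ∀ y ∈ s, DifferentiableAt ℝ f y := fun y hy => (hball hy).2.2
  have hsU : s ⊆ U := fun y hy => (hball hy).2.1
  -- the local flow
  obtain ⟨ε₁, hε₁, a, r, M, K', hr, hpl⟩ := IsPicardLindelof.of_contDiffAt_one hf1
  obtain ⟨α, hα, hαc⟩ := (hpl 0).exists_forall_mem_closedBall_eq_hasDerivWithinAt_continuousOn
  simp only [zero_sub, zero_add] at hα hαc
  have hr' : (0 : ℝ) < r := by exact_mod_cast hr
  have hαs : ∀ᶠ q in 𝓝 p ×ˢ 𝓝 (0 : ℝ), α q ∈ s := by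
    rw [← nhds_prod_eq]
    have hcont : ContinuousAt α (p, 0) := hαc.continuousAt
      (prod_mem_nhds (Metric.closedBall_mem_nhds p hr') (Icc_mem_nhds (by linarith) hε₁))
    have h0 : α (p, 0) = p := (hα p (Metric.mem_closedBall_self hr'.le)).1
    have := hcont.preimage_mem_nhds (t := s) (by rw [h0]; exact Metric.ball_mem_nhds p hR)
    exact this
  -- the linearised equation
  have hF : ContDiffAt ℝ 1 (fun q : E × (E →L[ℝ] E) => (f q.1, fderiv ℝ f q.1 ∘L q.2))
      (p, .id ℝ E) :=
    (hf1.comp (p, ContinuousLinearMap.id ℝ E) contDiffAt_fst).prodMk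
      ((hdf.comp (p, ContinuousLinearMap.id ℝ E) contDiffAt_fst).clm_comp contDiffAt_snd)
  -- `β` carries the central trajectory and its linearisation together, as one autonomous system. It
  -- is `C¹` because `f` is `C²`, so Picard–Lindelöf applies.
  obtain ⟨β, hβ0, ε₂, hε₂, hβ⟩ :=
    hF.exists_forall_mem_closedBall_exists_eq_forall_mem_Ioo_hasDerivAt₀ 0
  simp only [zero_sub, zero_add] at hβ
  have hβc : ContinuousAt β 0 := (hβ 0 ⟨by linarith, hε₂⟩).continuousAt
  -- The radii give `‖A t‖ ≤ 2`; then for `‖h‖ < R / 4` the point `c t + A t h` lies within `R / 2 +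
  -- 2 * (R / 4) = R` of `p`.
  have hβ1 : ∀ᶠ t in 𝓝 (0 : ℝ), (β t).1 ∈ Metric.ball p (R / 2) ∧
      (β t).2 ∈ Metric.ball (ContinuousLinearMap.id ℝ E) 1 := by
    have := hβc.preimage_mem_nhds (t := Metric.ball p (R / 2) ×ˢ
      Metric.ball (ContinuousLinearMap.id ℝ E) 1) (by
        rw [hβ0]
        exact prod_mem_nhds (Metric.ball_mem_nhds _ (by positivity))
          (Metric.ball_mem_nhds _ one_pos))
    exact this
  rw [Filter.eventually_prod_iff] at hαs
  obtain ⟨P, hP, Q, hQ, hPQ⟩ := hαs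
  obtain ⟨ε₃, hε₃, hε⟩ := Metric.eventually_nhds_iff_ball.1 (hQ.and hβ1)
  set ε := min ε₁ (min ε₂ ε₃) with hεdef
  have hεpos : 0 < ε := by positivity
  have hle1 : ε ≤ ε₁ := min_le_left _ _
  have hle2 : ε ≤ ε₂ := (min_le_right _ _).trans (min_le_left _ _)
  have hle3 : ε ≤ ε₃ := (min_le_right _ _).trans (min_le_right _ _)
  have hQ' : ∀ t ∈ Ioo (-ε) ε, Q t ∧ (β t).1 ∈ Metric.ball p (R / 2) ∧
      (β t).2 ∈ Metric.ball (ContinuousLinearMap.id ℝ E) 1 := fun t ht => by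
    apply hε t
    rw [Metric.mem_ball, Real.dist_eq, sub_zero, abs_lt]
    exact ⟨by linarith [ht.1], by linarith [ht.2]⟩
  have hflow : ∀ᶠ y in 𝓝 p, α (y, 0) = y ∧
      ∀ t ∈ Ioo (-ε) ε, HasDerivAt (fun t => α (y, t)) (f (α (y, t))) t ∧ α (y, t) ∈ s := by
    filter_upwards [hP, Metric.closedBall_mem_nhds p hr'] with y hy hyr
    refine ⟨(hα y hyr).1, fun t ht => ⟨?_, hPQ hy (hQ' t ht).1⟩⟩
    have h1 : -ε₁ < t := by linarith [ht.1]
    have h2 : t < ε₁ := by linarith [ht.2]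
    exact ((hα y hyr).2 t ⟨h1.le, h2.le⟩).hasDerivAt (Icc_mem_nhds h1 h2)
  have hβd : ∀ t ∈ Ioo (-ε) ε, HasDerivAt β (f (β t).1, fderiv ℝ f (β t).1 ∘L (β t).2) t :=
    fun t ht => hβ t ⟨by linarith [ht.1], by linarith [ht.2]⟩
  have hβ₁ : ∀ t ∈ Ioo (-ε) ε, HasDerivAt (fun t => (β t).1) (f (β t).1) t :=
    fun t ht => (ContinuousLinearMap.fst ℝ E (E →L[ℝ] E)).hasFDerivAt.comp_hasDerivAt t (hβd t ht)
  have hβ₂ : ∀ t ∈ Ioo (-ε) ε, HasDerivAt (fun t => (β t).2) (fderiv ℝ f (β t).1 ∘L (β t).2) t :=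
    fun t ht => (ContinuousLinearMap.snd ℝ E (E →L[ℝ] E)).hasFDerivAt.comp_hasDerivAt t (hβd t ht)
  have hβn : ∀ t ∈ Ioo (-ε) ε, ‖(β t).2‖ ≤ 2 := fun t ht => by
    have h1 := (hQ' t ht).2.2
    rw [Metric.mem_ball, dist_eq_norm] at h1
    have h2 : ‖ContinuousLinearMap.id ℝ E‖ ≤ 1 := ContinuousLinearMap.norm_id_le
    have h3 := norm_add_le ((β t).2 - ContinuousLinearMap.id ℝ E) (ContinuousLinearMap.id ℝ E)
    rw [sub_add_cancel] at h3
    linarith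
  have hβs : ∀ᶠ h in 𝓝 (0 : E), ∀ t ∈ Ioo (-ε) ε, (β t).1 + (β t).2 h ∈ s := by
    filter_upwards [Metric.ball_mem_nhds (0 : E) (show 0 < R / 4 by positivity)] with h hh t ht
    have h1 := (hQ' t ht).2.1
    rw [mem_ball_zero_iff] at hh
    have h2 : ‖(β t).2 h‖ ≤ 2 * ‖h‖ := ((β t).2).le_of_opNorm_le (hβn t ht) _
    rw [Metric.mem_ball, dist_eq_norm] at h1
    rw [hs, Metric.mem_ball, dist_eq_norm, add_sub_right_comm]
    refine (norm_add_le _ _).trans_lt ?_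
    linarith
  refine ⟨ε, hεpos, fun y t => α (y, t), ?_, fun T hT => ?_⟩
  · filter_upwards [hflow] with y hy
    exact ⟨hy.1, fun t ht => ⟨(hy.2 t ht).1, hsU (hy.2 t ht).2⟩⟩
  rcases le_total 0 T with h0 | h0
  · have hI : Icc 0 T ⊆ Ioo (-ε) ε := fun t ht => ⟨by linarith [ht.1], by linarith [ht.2, hT.2]⟩
    refine (hasFDerivAt_of_linearised hsc hdiff hK hL h0 (c := fun t => (β t).1)
      (A := fun t => (β t).2) (C := 2) (α := fun y t => α (y, t)) (by simp [hβ0]) (by simp [hβ0])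
      (fun t ht => hβ₁ t (hI ht)) (fun t ht => hβ₂ t (hI ht))
      (fun t ht => hβn t (hI ht)) ?_ ?_).differentiableAt
    · exact hβs.mono fun h hh t ht => hh t (hI ht)
    · exact hflow.mono fun y hy => ⟨hy.1, fun t ht => hy.2 t (hI ht)⟩
  -- Negative times reduce to positive ones by reversing time, which replaces `f` by `-f`.
  · have hI : ∀ t ∈ Icc 0 (-T), -t ∈ Ioo (-ε) ε := fun t ht =>
      ⟨by linarith [ht.2, hT.1], by linarith [ht.1]⟩
    have hneg : fderiv ℝ (-f) = fun y => -fderiv ℝ f y := by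
      funext y; exact fderiv_neg
    have := (hasFDerivAt_of_linearised (f := -f) (T := -T) (p := p) hsc
      (fun y hy => (hdiff y hy).neg) hK.neg (L := L) (by rw [hneg]; exact hL.neg)
      (by linarith) (c := fun t => (β (-t)).1)
      (A := fun t => (β (-t)).2) (C := 2) (α := fun y t => α (y, -t)) (by simp [hβ0])
      (by simp [hβ0])
      (fun t ht => by
        have := (hβ₁ (-t) (hI t ht)).scomp t (hasDerivAt_neg t)
        rw [neg_one_smul] at this
        exact this)
      (fun t ht => by
        have := (hβ₂ (-t) (hI t ht)).scomp t (hasDerivAt_neg t)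
        rw [neg_one_smul] at this
        rw [hneg, ContinuousLinearMap.neg_comp]
        exact this)
      (fun t ht => hβn _ (hI t ht)) ?_ ?_).differentiableAt
    · simpa using this
    · exact hβs.mono fun h hh t ht => hh _ (hI t ht)
    · refine hflow.mono fun y hy => ⟨by simpa using hy.1, fun t ht => ⟨?_, (hy.2 _ (hI t ht)).2⟩⟩
      have := (hy.2 _ (hI t ht)).1.scomp t (hasDerivAt_neg t)
      rw [neg_one_smul] at this
      exact this

end ODE

/-! ### The flow on the manifold and the tangent lift. -/

section Flow

/-- All tangent spaces are by definition the model space, so the fibre components can be compared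
there without transport along `h`. -/
theorem tangentBundle_mk_congr {n : ℕ} {M : Type*} [TopologicalSpace M] [ChartedSpace (Rn n) M]
    {x y : M} {v : TangentSpace (𝓡 n) x} {w : TangentSpace (𝓡 n) y}
    (h : x = y) (hvw : (v : Rn n) = w) :
    (⟨x, v⟩ : TangentBundle (𝓡 n) M) = ⟨y, w⟩ := by
  subst h
  exact congrArg (Bundle.TotalSpace.mk x) hvw

variable {n : ℕ} {M : Type*} [TopologicalSpace M] [ChartedSpace (Rn n) M]
  [IsManifold (𝓡 n) ∞ M]

/-- The flow of a `C¹` vector field is computed by any integral curve. -/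
theorem flow_eq_of_isMIntegralCurveOn [T2Space M] {X : Π y : M, TangentSpace (𝓡 n) y}
    (hX : ContMDiff (𝓡 n) (𝓡 n).tangent 1 (fun y => (⟨y, X y⟩ : TangentBundle (𝓡 n) M)))
    {γ : ℝ → M} {a b t : ℝ} (h0 : 0 ∈ Ioo a b) (ht : t ∈ Ioo a b)
    (hγ : IsMIntegralCurveOn γ X (Ioo a b)) : flow X t (γ 0) = γ t := by
  have : IsManifold (𝓡 n) 1 M := IsManifold.of_le (n := ∞) (by exact_mod_cast le_top)
  have h : ∃ γ' : ℝ → M, γ' 0 = γ 0 ∧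
      ∃ a b : ℝ, 0 ∈ Ioo a b ∧ t ∈ Ioo a b ∧ IsMIntegralCurveOn γ' X (Ioo a b) :=
    ⟨γ, rfl, a, b, h0, ht, hγ⟩
  rw [flow, dif_pos h]
  obtain ⟨h0', a', b', ha', ht', hγ'⟩ := h.choose_spec
  set γ' := h.choose
  exact isMIntegralCurveOn_Ioo_eqOn_of_contMDiff_boundaryless (t₀ := 0)
    (a := max a a') (b := min b b')
    ⟨max_lt h0.1 ha'.1, lt_min h0.2 ha'.2⟩ hX
    (hγ'.mono (Ioo_subset_Ioo (le_max_right _ _) (min_le_right _ _)))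
    (hγ.mono (Ioo_subset_Ioo (le_max_left _ _) (min_le_left _ _))) h0'
    ⟨max_lt ht.1 ht'.1, lt_min ht.2 ht'.2⟩

/-- The coordinate expression of a vector field in the preferred chart at `x`. -/
def chartField (X : Π y : M, TangentSpace (𝓡 n) y) (x : M) (z : Rn n) : Rn n :=
  tangentCoordChange (𝓡 n) ((extChartAt (𝓡 n) x).symm z) x ((extChartAt (𝓡 n) x).symm z)
    (X ((extChartAt (𝓡 n) x).symm z))

/-- `chartField` is the fibre component of the section `X` read in the charts at `x`. Order two is
what the linearised equation requires. -/
theorem contDiffAt_chartField {X : Π y : M, TangentSpace (𝓡 n) y}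
    (hX : ContMDiff (𝓡 n) (𝓡 n).tangent ∞ (fun y => (⟨y, X y⟩ : TangentBundle (𝓡 n) M))) (x : M) :
    ContDiffAt ℝ 2 (chartField X x) (extChartAt (𝓡 n) x x) := by
  have : IsManifold (𝓡 n) 1 M := IsManifold.of_le (n := ∞) (by exact_mod_cast le_top)
  have hv := (hX x).of_le (show (2 : WithTop ℕ∞) ≤ ∞ by
    exact WithTop.coe_le_coe.2 (le_top : (2 : ℕ∞) ≤ ⊤))
  rw [contMDiffAt_iff] at hv
  exact (hv.2.contDiffAt (range_mem_nhds_isInteriorPoint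
    BoundarylessManifold.isInteriorPoint)).snd

/-- A solution of the coordinate expression of a vector field is an integral curve. -/
theorem hasMFDerivAt_extChartAt_symm_comp {X : Π y : M, TangentSpace (𝓡 n) y} {x : M}
    {f : ℝ → Rn n} {t : ℝ} (hf : HasDerivAt f (chartField X x (f t)) t)
    (hft : f t ∈ (extChartAt (𝓡 n) x).target) :
    HasMFDerivAt 𝓘(ℝ, ℝ) (𝓡 n) ((extChartAt (𝓡 n) x).symm ∘ f) t
      ((1 : ℝ →L[ℝ] ℝ).smulRight (X ((extChartAt (𝓡 n) x).symm (f t)))) := by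
  have : IsManifold (𝓡 n) 1 M := IsManifold.of_le (n := ∞) (by exact_mod_cast le_top)
  let xₜ : M := (extChartAt (𝓡 n) x).symm (f t)
  have h : HasDerivAt f (tangentCoordChange (𝓡 n) xₜ x xₜ (X xₜ)) t := hf
  have hft1 := mem_preimage.mp <|
    mem_of_mem_of_subset hft (extChartAt (𝓡 n) x).target_subset_preimage_source
  have hft2 := mem_extChartAt_source (I := 𝓡 n) xₜ
  -- The manifold derivative at time `t` is read in the preferred chart at `xₜ`, not at `x`;
  -- changing charts back cancels the coordinate change in `chartField`.
  have key : HasDerivAt ((extChartAt (𝓡 n) xₜ ∘ (extChartAt (𝓡 n) x).symm) ∘ f)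
      (X xₜ : Rn n) t := by
    have hw : ∀ w : Rn n, tangentCoordChange (𝓡 n) x xₜ xₜ
        (tangentCoordChange (𝓡 n) xₜ x xₜ w) = w := fun w => by
      rw [tangentCoordChange_comp ⟨⟨hft2, hft1⟩, hft2⟩, tangentCoordChange_self hft2]
    rw [← hw (X xₜ)]
    apply HasFDerivAt.comp_hasDerivAt _ _ h
    apply HasFDerivWithinAt.hasFDerivAt (s := range (𝓡 n)) _ (by simp)
    rw [← (extChartAt (𝓡 n) x).right_inv hft]
    exact hasFDerivWithinAt_tangentCoordChange ⟨hft1, hft2⟩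
  refine ⟨(continuousAt_extChartAt_symm'' hft).comp h.continuousAt, ?_⟩
  have key' := key.hasFDerivAt.hasFDerivWithinAt (s := range 𝓘(ℝ, ℝ))
  refine HasFDerivWithinAt.congr_fderiv key' ?_
  ext
  rfl

/-- Near a point and for small times the flow is given by integral curves, and its time-`t` maps
are differentiable at that point. -/
theorem exists_flow_mdifferentiableAt [T2Space M] {X : Π y : M, TangentSpace (𝓡 n) y}
    (hX : ContMDiff (𝓡 n) (𝓡 n).tangent ∞ (fun y => (⟨y, X y⟩ : TangentBundle (𝓡 n) M))) (x : M) :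
    ∃ ε > 0, (∃ γ : ℝ → M, γ 0 = x ∧ IsMIntegralCurveOn γ X (Ioo (-ε) ε)) ∧
      ∀ t ∈ Ioo (-ε) ε, MDifferentiableAt (𝓡 n) (𝓡 n) (flow X t) x := by
  obtain ⟨ε, hε, α, hα, hd⟩ := exists_localFlow_differentiableAt (contDiffAt_chartField hX x)
    (extChartAt_target_mem_nhds (I := 𝓡 n) x)
  have hX1 := hX.of_le (show (1 : WithTop ℕ∞) ≤ ∞ by exact_mod_cast le_top)
  have h0 : (0 : ℝ) ∈ Ioo (-ε) ε := ⟨by linarith, hε⟩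
  have hcurve : ∀ᶠ z in 𝓝 (extChartAt (𝓡 n) x x),
      (extChartAt (𝓡 n) x).symm (α z 0) = (extChartAt (𝓡 n) x).symm z ∧
      IsMIntegralCurveOn ((extChartAt (𝓡 n) x).symm ∘ α z) X (Ioo (-ε) ε) := by
    filter_upwards [hα] with z hz
    exact ⟨by rw [hz.1], fun t ht => (hasMFDerivAt_extChartAt_symm_comp (hz.2 t ht).1
      (hz.2 t ht).2).hasMFDerivWithinAt⟩
  refine ⟨ε, hε, ⟨(extChartAt (𝓡 n) x).symm ∘ α (extChartAt (𝓡 n) x x), ?_,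
    hcurve.self_of_nhds.2⟩, fun t ht => ?_⟩
  · rw [Function.comp_apply, hcurve.self_of_nhds.1, extChartAt_to_inv]
  have heq : flow X t =ᶠ[𝓝 x]
      (extChartAt (𝓡 n) x).symm ∘ (fun z => α z t) ∘ extChartAt (𝓡 n) x := by
    filter_upwards [(continuousAt_extChartAt (I := 𝓡 n) x).eventually hcurve,
      extChartAt_source_mem_nhds (I := 𝓡 n) x] with y hy hys
    have := flow_eq_of_isMIntegralCurveOn hX1 h0 ht hy.2
    rwa [Function.comp_apply, hy.1, (extChartAt (𝓡 n) x).left_inv hys] at this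
  refine MDifferentiableAt.congr_of_eventuallyEq ?_ heq
  have hm1 : MDifferentiableAt (𝓡 n) 𝓘(ℝ, Rn n) (extChartAt (𝓡 n) x) x :=
    mdifferentiableAt_extChartAt (mem_chart_source _ x)
  have hm2 : MDifferentiableAt 𝓘(ℝ, Rn n) 𝓘(ℝ, Rn n) (fun z => α z t) (extChartAt (𝓡 n) x x) :=
    (hd t ht).mdifferentiableAt
  have hm3 : MDifferentiableAt 𝓘(ℝ, Rn n) (𝓡 n) (extChartAt (𝓡 n) x).symm
      (α (extChartAt (𝓡 n) x x) t) :=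
    ((contMDiffOn_extChartAt_symm (n := 1) x).contMDiffAt
      ((isOpen_extChartAt_target x).mem_nhds (hα.self_of_nhds.2 t ht).2)).mdifferentiableAt
      (by norm_num)
  exact hm3.comp x (hm2.comp x hm1)

/-- A `C^∞` vector field is invariant under its own flow. -/
theorem tangentMap_flow_eventuallyEq [T2Space M] {X : Π y : M, TangentSpace (𝓡 n) y}
    (hX : ContMDiff (𝓡 n) (𝓡 n).tangent ∞ (fun y => (⟨y, X y⟩ : TangentBundle (𝓡 n) M))) (x : M) :
    ∃ γ : ℝ → M, γ 0 = x ∧ HasMFDerivAt 𝓘(ℝ, ℝ) (𝓡 n) γ 0 ((1 : ℝ →L[ℝ] ℝ).smulRight (X x)) ∧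
      (fun t => tangentMap (𝓡 n) (𝓡 n) (flow X t) ⟨x, X x⟩) =ᶠ[𝓝 0] fun t => ⟨γ t, X (γ t)⟩ := by
  obtain ⟨ε, hε, ⟨γ, hγ0, hγ⟩, hd⟩ := exists_flow_mdifferentiableAt hX x
  have hX1 := hX.of_le (show (1 : WithTop ℕ∞) ≤ ∞ by exact_mod_cast le_top)
  have hγd : ∀ t ∈ Ioo (-ε) ε, HasMFDerivAt 𝓘(ℝ, ℝ) (𝓡 n) γ t
      ((1 : ℝ →L[ℝ] ℝ).smulRight (X (γ t))) := fun t ht =>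
    (hγ t ht).hasMFDerivAt (Ioo_mem_nhds ht.1 ht.2)
  have h0 : (0 : ℝ) ∈ Ioo (-ε) ε := ⟨by linarith, hε⟩
  subst hγ0
  refine ⟨γ, rfl, hγd 0 h0, ?_⟩
  filter_upwards [Ioo_mem_nhds h0.1 h0.2] with t ht
  have hflow0 : flow X t (γ 0) = γ t := flow_eq_of_isMIntegralCurveOn hX1 h0 ht hγ
  -- The group law along `γ`: the translate of `γ` by `s` is an integral curve starting at `γ s`, on
  -- an interval that contains `0` and `t` for small `s`.
  have hev : (fun s => flow X t (γ s)) =ᶠ[𝓝 0] fun s => γ (s + t) := by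
    have hs : ∀ᶠ s : ℝ in 𝓝 0, s ∈ Ioo (-ε) ε ∧ s + t ∈ Ioo (-ε) ε := by
      have : ContinuousAt (fun s : ℝ => s + t) 0 := by fun_prop
      exact Filter.inter_mem (Ioo_mem_nhds h0.1 h0.2)
        (this.preimage_mem_nhds (t := Ioo (-ε) ε)
          (by rw [zero_add]; exact Ioo_mem_nhds ht.1 ht.2))
    filter_upwards [hs] with s hs
    have := flow_eq_of_isMIntegralCurveOn hX1 (γ := γ ∘ (· + s)) (a := -ε - s) (b := ε - s)
      (t := t) ⟨by linarith [hs.1.1], by linarith [hs.1.2]⟩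
      ⟨by linarith [hs.2.1], by linarith [hs.2.2]⟩ ((hγ.comp_add s).mono fun τ hτ =>
        ⟨by linarith [hτ.1], by linarith [hτ.2]⟩)
    simpa [add_comm] using this
  have h1 := (hd t ht).hasMFDerivAt.comp 0 (hγd 0 h0)
  have h2 : HasMFDerivAt 𝓘(ℝ, ℝ) (𝓡 n) (γ ∘ (· + t)) 0
      ((1 : ℝ →L[ℝ] ℝ).smulRight (X (γ (0 + t)))) := by
    refine (hγ.comp_add t 0 (by simpa using ht)).hasMFDerivAt ?_
    have : ContinuousAt (fun s : ℝ => s + t) 0 := by fun_prop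
    exact this.preimage_mem_nhds (by rw [zero_add]; exact Ioo_mem_nhds ht.1 ht.2)
  have h3 := hasMFDerivAt_unique h1 (h2.congr_of_eventuallyEq hev)
  have h4 := congrArg (fun l : ℝ →L[ℝ] Rn n => l 1) h3
  have h5 : (mfderiv (𝓡 n) (𝓡 n) (flow X t) (γ 0) (X (γ 0)) : Rn n) = X (γ t) := by
    have h6 : ∀ s, s = t → (X (γ s) : Rn n) = X (γ t) := by rintro _ rfl; rfl
    change mfderiv (𝓡 n) (𝓡 n) (flow X t) (γ 0) ((1 : ℝ) • X (γ 0)) = (1 : ℝ) • X (γ (0 + t)) at h4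
    rw [one_smul, one_smul] at h4
    exact h4.trans (h6 _ (zero_add t))
  exact tangentBundle_mk_congr hflow0 h5

/-- `curveVelocity` is the value of the manifold derivative, after identifying the tangent spaces
with the model space. -/
theorem curveVelocity_eq {F : Type*} [NormedAddCommGroup F] [NormedSpace ℝ F]
    {H : Type*} [TopologicalSpace H] (J : ModelWithCorners ℝ F H)
    {N : Type*} [TopologicalSpace N] [ChartedSpace H N]
    (γ : ℝ → N) (p : N) (h : γ 0 = p) :
    (curveVelocity J γ p h : F) = (mfderiv 𝓘(ℝ, ℝ) J γ 0 (1 : ℝ) : F) := by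
  subst h; rfl

/-- The tangent lift of `X` at the vector `X x` is the derivative of `X` in the direction `X x`. -/
theorem tangentLift_apply_self [T2Space M] {X : Π y : M, TangentSpace (𝓡 n) y}
    (hX : ContMDiff (𝓡 n) (𝓡 n).tangent ∞ (fun y => (⟨y, X y⟩ : TangentBundle (𝓡 n) M))) (x : M) :
    tangentLift X ⟨x, X x⟩ =
      mfderiv (𝓡 n) (𝓡 n).tangent (fun y => (⟨y, X y⟩ : TangentBundle (𝓡 n) M)) x (X x) := by
  obtain ⟨γ, rfl, hγ, hev⟩ := tangentMap_flow_eventuallyEq hX x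
  refine (curveVelocity_eq (𝓡 n).tangent (fun t => tangentMap (𝓡 n) (𝓡 n) (flow X t)
    ⟨γ 0, X (γ 0)⟩) _ (tangentMap_flow_zero X _)).trans ?_
  have hS : MDifferentiableAt (𝓡 n) (𝓡 n).tangent
      (fun y => (⟨y, X y⟩ : TangentBundle (𝓡 n) M)) (γ 0) :=
    (hX (γ 0)).mdifferentiableAt (by simp)
  have h := (hS.hasMFDerivAt.comp 0 hγ).congr_of_eventuallyEq hev
  have h1 := congrArg (fun l : ℝ →L[ℝ] Rn n × Rn n => l 1) h.mfderiv
  refine h1.trans ?_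
  change mfderiv (𝓡 n) (𝓡 n).tangent (fun y => (⟨y, X y⟩ : TangentBundle (𝓡 n) M)) (γ 0)
    ((1 : ℝ) • X (γ 0)) = _
  rw [one_smul]

end Flow

/-! ### Calculus on the frame bundle, horizontal lifts and the spray. -/

section Frames

variable {n : ℕ} {M : Type*} [TopologicalSpace M] [ChartedSpace (Rn n) M]
  [IsManifold (𝓡 n) ∞ M]

open FrameBundle

theorem contMDiff_frame_val :
    ContMDiff (frameModel n) (frameModel n) ∞ (Subtype.val : FrameBundle n M → HomBundle n M) :=
  contMDiff_subtype_val

theorem contMDiff_frame_proj :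
    ContMDiff (frameModel n) (𝓡 n) ∞ (proj : FrameBundle n M → M) :=
  (contMDiff_proj (IB := 𝓡 n) (F := gl n)
    (fun x : M => Bundle.Trivial M (Rn n) x →L[ℝ] TangentSpace (𝓡 n) x)).comp contMDiff_frame_val

/-- The evaluation map `L(M) × ℝⁿ → TM`, `(u, η) ↦ u η`, is smooth. -/
theorem contMDiff_frame_eval :
    ContMDiff ((frameModel n).prod 𝓘(ℝ, Rn n)) (𝓡 n).tangent ∞
      (fun q : FrameBundle n M × Rn n => assoc q.2 q.1) := by
  have h1 : ContMDiff ((frameModel n).prod 𝓘(ℝ, Rn n)) (frameModel n) ∞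
      (fun q : FrameBundle n M × Rn n => (q.1.1 : HomBundle n M)) :=
    contMDiff_frame_val.comp contMDiff_fst
  have h2 : ContMDiff ((frameModel n).prod 𝓘(ℝ, Rn n)) ((𝓡 n).prod 𝓘(ℝ, Rn n)) ∞
      (fun q : FrameBundle n M × Rn n =>
        TotalSpace.mk' (Rn n) (E := Bundle.Trivial M (Rn n)) (proj q.1) q.2) := by
    intro q
    rw [contMDiffAt_totalSpace]
    exact ⟨(contMDiff_frame_proj.comp contMDiff_fst) q, contMDiff_snd q⟩
  exact ContMDiff.clm_bundle_apply (F₁ := Rn n) (E₁ := Bundle.Trivial M (Rn n)) (F₂ := Rn n)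
    (E₂ := (TangentSpace (𝓡 n) : M → Type _)) (b := fun q : FrameBundle n M × Rn n => proj q.1)
    (ϕ := fun q => toMap q.1) (v := fun q => q.2) h1 h2

/-- The function `f_X` of a smooth vector field is smooth. -/
theorem contMDiff_coordFun {X : Π y : M, TangentSpace (𝓡 n) y}
    (hX : ContMDiff (𝓡 n) (𝓡 n).tangent ∞ (fun y => (⟨y, X y⟩ : TangentBundle (𝓡 n) M))) :
    ContMDiff (frameModel n) 𝓘(ℝ, Rn n) ∞ (coordFun X) := by
  intro u
  have h1 := ((contMDiffAt_hom_bundle _).1 (contMDiff_frame_val (n := n) (M := M) u)).2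
  have h2 := (contMDiffAt_totalSpace.1 ((hX.comp contMDiff_frame_proj) u)).2
  set A : FrameBundle n M → gl n := fun u' =>
    ContinuousLinearMap.inCoordinates (Rn n) (Bundle.Trivial M (Rn n)) (Rn n)
      (TangentSpace (𝓡 n) : M → Type _) u.1.1 u'.1.1 u.1.1 u'.1.1 u'.1.2 with hA
  set e₂ := trivializationAt (Rn n) (TangentSpace (𝓡 n) : M → Type _) u.1.1 with he₂
  set e₁ := trivializationAt (Rn n) (Bundle.Trivial M (Rn n)) u.1.1 with he₁
  -- In a trivialisation `f_X` is the inverse of the matrix of the frame applied to the components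
  -- of `X`, and inversion is smooth at invertible maps.
  have hb : ∀ u' : FrameBundle n M, proj u' ∈ e₂.baseSet →
      (A u').IsInvertible ∧ coordFun X u' = (A u').inverse (e₂ ⟨proj u', X (proj u')⟩).2 := by
    intro u' hu'
    have hu1 : proj u' ∈ e₁.baseSet := trivial
    have hAe : A u' = (e₂.continuousLinearEquivAt ℝ (proj u') hu' : _ →L[ℝ] Rn n) ∘L
        (toMap u' ∘L ((e₁.continuousLinearEquivAt ℝ (proj u') hu1).symm : Rn n →L[ℝ] _)) :=
      ContinuousLinearMap.inCoordinates_eq hu1 hu'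
    constructor
    · rw [hAe, ContinuousLinearMap.isInvertible_equiv_comp,
        ContinuousLinearMap.isInvertible_comp_equiv]
      exact isInvertible_toMap u'
    · rw [hAe, ContinuousLinearMap.inverse_equiv_comp, ContinuousLinearMap.inverse_comp_equiv]
      have : (e₂ ⟨proj u', X (proj u')⟩).2 =
        e₂.continuousLinearEquivAt ℝ (proj u') hu' (X (proj u')) := rfl
      rw [this]
      change coordFun X u' = e₁.continuousLinearEquivAt ℝ (proj u') hu1 ((toMap u').inverse
        ((e₂.continuousLinearEquivAt ℝ (proj u') hu').symm
          (e₂.continuousLinearEquivAt ℝ (proj u') hu' (X (proj u')))))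
      rw [ContinuousLinearEquiv.symm_apply_apply]
      rfl
  have hnhds : ∀ᶠ u' in 𝓝 u, proj u' ∈ e₂.baseSet :=
    (contMDiff_frame_proj u).continuousAt.preimage_mem_nhds
      (e₂.open_baseSet.mem_nhds (FiberBundle.mem_baseSet_trivializationAt' _))
  have hinv : ContMDiffAt (frameModel n) 𝓘(ℝ, gl n) ∞ (fun u' => (A u').inverse) u :=
    (ContinuousLinearMap.IsInvertible.contDiffAt_map_inverse
      (hb u hnhds.self_of_nhds).1).contMDiffAt.comp u h1
  refine (hinv.clm_apply h2).congr_of_eventuallyEq ?_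
  filter_upwards [hnhds] with u' hu'
  exact (hb u' hu').2

/-- The projection `L(M) → M` is a submersion. -/
theorem mfderiv_proj_surjective (u : FrameBundle n M) :
    Function.Surjective (mfderiv (frameModel n) (𝓡 n) (proj : FrameBundle n M → M) u) := by
  intro w
  have hP : MDifferentiableAt (frameModel n) (𝓡 n) (proj : FrameBundle n M → M) u :=
    (contMDiff_frame_proj u).mdifferentiableAt (by simp)
  -- In bundle charts the projection is `Prod.fst`, so `(e₂ w, 0)` will provide a preimage of `w`.
  have hcomm : extChartAt (𝓡 n) (proj u) ∘ (proj : FrameBundle n M → M) =ᶠ[𝓝 u]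
      Prod.fst ∘ extChartAt (frameModel n) u := by
    filter_upwards [(contMDiff_frame_val u).continuousAt.preimage_mem_nhds
      (extChartAt_source_mem_nhds (I := frameModel n) u.1)] with u' h2
    rw [mem_preimage] at h2
    rw [FiberBundle.extChartAt] at h2
    change _ = (extChartAt (frameModel n) u.1 u'.1).1
    rw [FiberBundle.extChartAt]
    have h3 := (Trivialization.coe_fst (trivializationAt (gl n) (fun x : M =>
      Bundle.Trivial M (Rn n) x →L[ℝ] TangentSpace (𝓡 n) x) u.1.1) (x := u'.1) h2.1)
    exact congrArg (extChartAt (𝓡 n) (proj u)) h3.symm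
  have hχ : MDifferentiableAt (𝓡 n) 𝓘(ℝ, Rn n) (extChartAt (𝓡 n) (proj u)) (proj u) :=
    mdifferentiableAt_extChartAt (mem_chart_source _ _)
  have hχ' : MDifferentiableAt (frameModel n) 𝓘(ℝ, Rn n × gl n) (extChartAt (frameModel n) u) u :=
    mdifferentiableAt_extChartAt (mem_chart_source _ _)
  have hfst : MDifferentiableAt 𝓘(ℝ, Rn n × gl n) 𝓘(ℝ, Rn n) (Prod.fst : Rn n × gl n → Rn n)
      (extChartAt (frameModel n) u u) := differentiableAt_fst.mdifferentiableAt
  obtain ⟨e₁, he₁⟩ := isInvertible_mfderiv_extChartAt (I := frameModel n) (mem_extChartAt_source u)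
  obtain ⟨e₂, he₂⟩ := isInvertible_mfderiv_extChartAt (I := 𝓡 n) (mem_extChartAt_source (proj u))
  refine ⟨e₁.symm (e₂ w, 0), e₂.injective ?_⟩
  have h1 := mfderiv_comp_apply u hχ hP (e₁.symm (e₂ w, 0))
  have h2 := mfderiv_comp_apply u hfst hχ' (e₁.symm (e₂ w, 0))
  have h3 : e₁ (e₁.symm (e₂ w, 0)) = (e₂ w, 0) := e₁.apply_symm_apply _
  have h4 := congrArg (fun l : (Rn n × gl n) →L[ℝ] Rn n => l (e₁.symm (e₂ w, 0)))
    (hcomm.mfderiv_eq (I := frameModel n) (I' := 𝓡 n))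
  rw [← he₁] at h2
  rw [← he₂] at h1
  refine h1.symm.trans (h4.trans (h2.trans ?_))
  rw [mfderiv_eq_fderiv, fderiv_fst]
  exact congrArg Prod.fst h3

/-- A curve in a fibre of `L(M)` has vertical velocity. -/
theorem mfderiv_proj_curveVelocity {γ : ℝ → FrameBundle n M} {u : FrameBundle n M} (h : γ 0 = u)
    (hγ : ∀ t, proj (γ t) = proj u) :
    mfderiv (frameModel n) (𝓡 n) (proj : FrameBundle n M → M) u
      (curveVelocity (frameModel n) γ u h) = 0 := by
  subst h
  change mfderiv (frameModel n) (𝓡 n) (proj : FrameBundle n M → M) (γ 0)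
    (mfderiv 𝓘(ℝ, ℝ) (frameModel n) γ 0 (1 : ℝ)) = 0
  by_cases hd : MDifferentiableAt 𝓘(ℝ, ℝ) (frameModel n) γ 0
  · have hP : MDifferentiableAt (frameModel n) (𝓡 n) (proj : FrameBundle n M → M) (γ 0) :=
      (contMDiff_frame_proj _).mdifferentiableAt (by simp)
    have h1 := mfderiv_comp 0 hP hd
    have h2 : (proj : FrameBundle n M → M) ∘ γ = fun _ => proj (γ 0) := funext hγ
    have h3 : mfderiv 𝓘(ℝ, ℝ) (𝓡 n) ((proj : FrameBundle n M → M) ∘ γ) 0 = 0 := by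
      rw [h2]; exact mfderiv_const
    rw [h3] at h1
    exact (congrArg (fun l : ℝ →L[ℝ] Rn n => l 1) h1).symm
  -- A non-differentiable curve has velocity zero by default, so no regularity of `γ` is needed.
  · rw [mfderiv_zero_of_not_mdifferentiableAt hd]
    exact ContinuousLinearMap.map_zero _

/-- Subtract from any lift `B` of `w` the generator of `ω(B)`: it is vertical, so the projection is
unchanged, and `ω` takes the value `ω(B)` on it. Existence suffices, because the spray and `∇` use
the same chosen lift. -/
theorem LinearConnection.horLift_spec (conn : LinearConnection n M) (u : FrameBundle n M)
    (w : TangentSpace (𝓡 n) (proj u)) :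
    conn.form u (conn.horLift u w) = 0 ∧
      mfderiv (frameModel n) (𝓡 n) (proj : FrameBundle n M → M) u (conn.horLift u w) = w := by
  refine Classical.epsilon_spec (p := fun B : TangentSpace (frameModel n) u =>
    conn.form u B = 0 ∧ mfderiv (frameModel n) (𝓡 n) (proj : FrameBundle n M → M) u B = w) ?_
  obtain ⟨B, hB⟩ := mfderiv_proj_surjective u w
  refine ⟨B - generator (conn.form u B) u, ?_, ?_⟩
  · rw [ContinuousLinearMap.map_sub, conn.form_generator, sub_self]
  · rw [ContinuousLinearMap.map_sub, hB]
    have : mfderiv (frameModel n) (𝓡 n) (proj : FrameBundle n M → M) u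
      (generator (conn.form u B) u) = 0 := mfderiv_proj_curveVelocity _ fun _ => rfl
    rw [this, sub_zero]

/-- The chain rule for `z ↦ Ψ (z, f z)`, in terms of the partial derivatives of `Ψ`. -/
theorem mfderiv_comp_graph {E E' F : Type*} [NormedAddCommGroup E] [NormedSpace ℝ E]
    [NormedAddCommGroup E'] [NormedSpace ℝ E'] [NormedAddCommGroup F] [NormedSpace ℝ F]
    {H H' G : Type*} [TopologicalSpace H] [TopologicalSpace H'] [TopologicalSpace G]
    {I : ModelWithCorners ℝ E H} {I' : ModelWithCorners ℝ E' H'} {J : ModelWithCorners ℝ F G}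
    {N N' P : Type*} [TopologicalSpace N] [ChartedSpace H N] [TopologicalSpace N']
    [ChartedSpace H' N'] [TopologicalSpace P] [ChartedSpace G P]
    {Ψ : N × N' → P} {f : N → N'} {z : N} (hΨ : MDifferentiableAt (I.prod I') J Ψ (z, f z))
    (hf : MDifferentiableAt I I' f z) (B : TangentSpace I z) :
    mfderiv I J (fun y => Ψ (y, f y)) z B =
      mfderiv I J (fun y => Ψ (y, f z)) z B +
        mfderiv I' J (fun y => Ψ (z, y)) (f z) (mfderiv I I' f z B) := by
  have hG : HasMFDerivAt I (I.prod I') (fun y => (y, f y)) z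
      ((ContinuousLinearMap.id ℝ (TangentSpace I z)).prod (mfderiv I I' f z)) :=
    (hasMFDerivAt_id z).prodMk hf.hasMFDerivAt
  have h := (hΨ.hasMFDerivAt.comp z hG).mfderiv
  have h3 := congrArg (fun l : E →L[ℝ] F => l B) h
  refine h3.trans ?_
  exact mfderiv_prod_eq_add_apply (E := E) (E' := E') (I := I) (I' := I') (p := (z, f z))
    (v := ((B : E), (mfderiv I I' f z B : E'))) hΨ

/-- The derivative of a smooth vector field `X` along a vector at the frame `u`, split into the
variation of the frame and the variation of the coordinates of `X`. -/
theorem mfderiv_section_eq_add {X : Π y : M, TangentSpace (𝓡 n) y}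
    (hX : ContMDiff (𝓡 n) (𝓡 n).tangent ∞ (fun y => (⟨y, X y⟩ : TangentBundle (𝓡 n) M)))
    (u : FrameBundle n M) (B : TangentSpace (frameModel n) u) :
    (mfderiv (𝓡 n) (𝓡 n).tangent (fun y => (⟨y, X y⟩ : TangentBundle (𝓡 n) M)) (proj u)
        (mfderiv (frameModel n) (𝓡 n) (proj : FrameBundle n M → M) u B) : Rn n × Rn n) =
      (mfderiv (frameModel n) (𝓡 n).tangent (assoc (coordFun X u)) u B : Rn n × Rn n) +
      (mfderiv 𝓘(ℝ, Rn n) (𝓡 n).tangent (fun η => assoc η u) (coordFun X u)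
        (mfderiv (frameModel n) 𝓘(ℝ, Rn n) (coordFun X) u B) : Rn n × Rn n) := by
  have hP : MDifferentiableAt (frameModel n) (𝓡 n) (proj : FrameBundle n M → M) u :=
    (contMDiff_frame_proj u).mdifferentiableAt (by simp)
  have hS : MDifferentiableAt (𝓡 n) (𝓡 n).tangent
      (fun y => (⟨y, X y⟩ : TangentBundle (𝓡 n) M)) (proj u) :=
    (hX (proj u)).mdifferentiableAt (by simp)
  have hf : MDifferentiableAt (frameModel n) 𝓘(ℝ, Rn n) (coordFun X) u :=
    (contMDiff_coordFun hX u).mdifferentiableAt (by simp)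
  have hE : MDifferentiableAt ((frameModel n).prod 𝓘(ℝ, Rn n)) (𝓡 n).tangent
      (fun q : FrameBundle n M × Rn n => assoc q.2 q.1) (u, coordFun X u) :=
    (contMDiff_frame_eval _).mdifferentiableAt (by simp)
  -- This is `X(π(u')) = u' (u'⁻¹ X(π(u')))`.
  have hfun : (fun y => (⟨y, X y⟩ : TangentBundle (𝓡 n) M)) ∘ (proj : FrameBundle n M → M) =
      fun u' => assoc (coordFun X u') u' := by
    funext u'
    exact congrArg (Bundle.TotalSpace.mk (proj u'))
      ((isInvertible_toMap u').self_apply_inverse (X (proj u'))).symm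
  have h1 := mfderiv_comp_apply u hS hP B
  rw [hfun] at h1
  have h2 := mfderiv_comp_graph hE hf B
  exact h1.symm.trans h2

/-- The vertical lift at `u ξ` of `u ζ` is the derivative of `u` at `ξ` in the direction `ζ`. -/
theorem vlft_toMap (u : FrameBundle n M) (ξ ζ : Rn n) :
    (vlft (toMap u ξ) (toMap u ζ) : Rn n × Rn n) =
      (mfderiv 𝓘(ℝ, Rn n) (𝓡 n).tangent (fun η => assoc η u) ξ ζ : Rn n × Rn n) := by
  refine (curveVelocity_eq (𝓡 n).tangent (fun t : ℝ =>
    (⟨proj u, toMap u ξ + t • toMap u ζ⟩ : TangentBundle (𝓡 n) M))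
    ⟨proj u, toMap u ξ⟩ (by simp)).trans ?_
  have hE : MDifferentiableAt 𝓘(ℝ, Rn n) (𝓡 n).tangent (fun η => assoc η u) ξ :=
    ((contMDiff_frame_eval.comp (contMDiff_const.prodMk contMDiff_id)) ξ).mdifferentiableAt
      (by simp)
  have hline : HasDerivAt (fun t : ℝ => ξ + t • ζ) ζ 0 := by
    simpa using ((hasDerivAt_id (0 : ℝ)).smul_const ζ).const_add ξ
  have h0 : ξ + (0 : ℝ) • ζ = ξ := by simp
  have hcurve : (fun t : ℝ => (⟨proj u, toMap u ξ + t • toMap u ζ⟩ : TangentBundle (𝓡 n) M)) =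
      (fun η => assoc η u) ∘ fun t : ℝ => ξ + t • ζ := by
    funext t
    refine congrArg (Bundle.TotalSpace.mk (proj u)) ?_
    rw [map_add, map_smul]
  have hd : MDifferentiableAt 𝓘(ℝ, ℝ) 𝓘(ℝ, Rn n) (fun t : ℝ => ξ + t • ζ) 0 :=
    hline.hasFDerivAt.differentiableAt.mdifferentiableAt
  have h1 := mfderiv_comp_apply_of_eq 0 hE hd h0 (1 : ℝ)
  have h2 : (mfderiv 𝓘(ℝ, ℝ) 𝓘(ℝ, Rn n) (fun t : ℝ => ξ + t • ζ) 0 (1 : ℝ) : Rn n) = ζ := by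
    rw [mfderiv_eq_fderiv, hline.hasFDerivAt.fderiv]
    exact one_smul ℝ ζ
  rw [hcurve]
  exact h1.trans (congrArg (mfderiv 𝓘(ℝ, Rn n) (𝓡 n).tangent (fun η => assoc η u) ξ :
    Rn n → Rn n × Rn n) h2)

theorem tangentSpace_cast_eq {F : Type*} [NormedAddCommGroup F] [NormedSpace ℝ F]
    {H : Type*} [TopologicalSpace H] (J : ModelWithCorners ℝ F H)
    {N : Type*} [TopologicalSpace N] [ChartedSpace H N] {p q : N} (h : p = q)
    (w : TangentSpace J p) : ((h ▸ w : TangentSpace J q) : F) = w := by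
  subst h; rfl

/-- The tangent space at `x` is by definition `ℝⁿ`, so the identity is a frame. Hence the condition
defining the spray is never vacuous. -/
theorem exists_frame (x : M) (v : TangentSpace (𝓡 n) x) :
    ∃ (u : FrameBundle n M) (ξ : Rn n), assoc ξ u = ⟨x, v⟩ :=
  ⟨⟨⟨x, ContinuousLinearMap.id ℝ (Rn n)⟩, ⟨ContinuousLinearEquiv.refl ℝ (Rn n), rfl⟩⟩, v, rfl⟩

/-- A single pair `(u, ξ)` over `v` already determines the vector, so any `Z` meeting the condition
for all pairs is the chosen one. The hypothesis compares vectors in the model space, free of casts.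
-/
theorem LinearConnection.geodesicSpray_eq (conn : LinearConnection n M)
    {v : TangentBundle (𝓡 n) M} {Z : TangentSpace (𝓡 n).tangent v}
    (hZ : ∀ (u : FrameBundle n M) (ξ : Rn n), assoc ξ u = v →
      (Z : Rn n × Rn n) = mfderiv (frameModel n) (𝓡 n).tangent (assoc ξ) u (conn.stdHor ξ u)) :
    conn.geodesicSpray v = Z := by
  have hZ' : ∀ (u : FrameBundle n M) (ξ : Rn n) (h : assoc ξ u = v),
      Z = h ▸ (mfderiv (frameModel n) (𝓡 n).tangent (assoc ξ) u (conn.stdHor ξ u) :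
        TangentSpace (𝓡 n).tangent (assoc ξ u)) := fun u ξ h =>
    (hZ u ξ h).trans (tangentSpace_cast_eq (𝓡 n).tangent h _).symm
  have hspec := Classical.epsilon_spec (p := fun Z : TangentSpace (𝓡 n).tangent v =>
    ∀ (u : FrameBundle n M) (ξ : Rn n) (h : assoc ξ u = v),
      Z = h ▸ (mfderiv (frameModel n) (𝓡 n).tangent (assoc ξ) u (conn.stdHor ξ u) :
        TangentSpace (𝓡 n).tangent (assoc ξ u))) ⟨Z, hZ'⟩
  obtain ⟨u, ξ, h⟩ := exists_frame v.1 v.2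
  exact (hspec u ξ h).trans (hZ' u ξ h).symm

end Frames

end FrameSpray

end

open FrameSpray in
theorem mainTheorem2 {n : ℕ} {M : Type*} [TopologicalSpace M] [T2Space M]
    [ChartedSpace (EuclideanSpace ℝ (Fin n)) M] [IsManifold (𝓡 n) ∞ M]
    (conn : LinearConnection n M)
    (nabla : CovariantDerivative (𝓡 n) (EuclideanSpace ℝ (Fin n))
      (TangentSpace (𝓡 n) : M → Type _))
    (hconn : conn.Corresponds nabla)
    (x : M) (v : TangentSpace (𝓡 n) x)
    (X : Π y : M, TangentSpace (𝓡 n) y)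
    (hX : ContMDiff (𝓡 n) (𝓡 n).tangent ∞ (fun y => (⟨y, X y⟩ : TangentBundle (𝓡 n) M)))
    (hXv : X x = v) :
    conn.geodesicSpray ⟨x, v⟩ = tangentLift X ⟨x, v⟩ - vlft v (nabla X x (X x)) := by
  subst hXv
  refine conn.geodesicSpray_eq fun u ξ h => ?_
  obtain rfl : FrameBundle.proj u = x := congrArg Bundle.TotalSpace.proj h
  have hξ : FrameBundle.toMap u ξ = X (FrameBundle.proj u) :=
    eq_of_heq (Bundle.TotalSpace.mk.inj h).2
  -- The splitting below freezes the second argument at `f_X(u)`; this identifies it with the `ξ` of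
  -- the spray.
  have hξ' : ξ = FrameBundle.coordFun X u :=
    ((FrameBundle.isInvertible_toMap u).inverse_apply_eq.2 hξ.symm).symm
  have hB := (conn.horLift_spec u (X (FrameBundle.proj u))).2
  have key := mfderiv_section_eq_add hX u (conn.horLift u (X (FrameBundle.proj u)))
  rw [hB] at key
  rw [tangentLift_apply_self hX, hconn X hX u]
  have hv := vlft_toMap u ξ (mfderiv (frameModel n) 𝓘(ℝ, Rn n) (FrameBundle.coordFun X) u
    (conn.horLift u (X (FrameBundle.proj u))))
  rw [hξ] at hv
  -- The subtraction is taken in the model space, where `key` has the form `TX(v) = TΦ_ξ(B) +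
  -- vertical part`.
  refine (sub_eq_iff_eq_add (G := Rn n × Rn n)).2 ?_
  refine key.trans ?_
  subst hξ'
  unfold LinearConnection.stdHor
  rw [hξ]
  exact congrArg _ hv.symm
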